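/- \textbf{Theorem.} Let $\mathbb{k}$ be an arbitrary field, let $n\in\mathbb N$, write $[n]=\{0,\dots,n-1\}$, and let $\mathsf C\subseteq[n\to 2]$ be any class (set) of functions $[n]\to[2]=\{0,1\}$. Then $$\dim_{\mathrm h}\mathsf C\;\ge\;\dim_{\mathrm{VC}}\mathsf C .$$ Here $S=\mathbb{k}[x_{i,j}: i\in[n],\,j\in[2]]$, and for $\sigma\subseteq[n]\times[2]$ we put $\mathbf x^\sigma=\prod_{(i,j)\in\sigma}x_{i,j}$ and $\mathfrak m^\sigma=\langle x_{i,j}:(i,j)\in\sigma\rangle$. The canonical suboplex $\mathcal S_{\mathsf C}$ is the simplicial complex on $[n]\times[2]$ whose faces are the sets $\sigma$ contained in the graph $\{(i,f(i)): i\in[n]\}$ of some $f\in\mathsf C$ (it is the void complex, without any face, if $\mathsf C=\emptyset$). Its Stanley–Reisner ideal is $I_{\mathsf C}=\langle\mathbf x^\tau:\tau\notin\mathcal S_{\mathsf C}\rangle\subseteq S$, and the canonical ideal of $\mathsf C$ is the Alexander dual $I_{\mathsf C}^\star=\bigcap_{\tau\notin\mathcal S_{\mathsf C}}\mathfrak m^\tau$.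 The homological dimension $\dim_{\mathrm h}\mathsf C$ is the projective dimension of the $S$-module $I_{\mathsf C}^\star$. The class $\mathsf C$ shatters $U\subseteq[n]$ if $\{f|_U: f\in\mathsf C\}$ is the set of all functions $U\to\{0,1\}$, and $\dim_{\mathrm{VC}}\mathsf C$ is the largest $|U|$ of a set $U\subseteq[n]$ shattered by $\mathsf C$. For $\mathsf C=\emptyset$, where $I_{\mathsf C}^\star=0$ and no set is shattered, both dimensions are $-\infty$ by convention. -/

import Mathlib

/-! ### Squarefree monomial ideals, Stanley-Reisner ideals and Alexander duality -/

section CombinatorialCommutativeAlgebra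

variable {V : Type*}

/-- The squarefree monomial `x^σ = ∏_{v ∈ σ} x_v`. -/
noncomputable def sqfreeMonomial (k : Type*) [Field k] (σ : Finset V) : MvPolynomial V k :=
  ∏ v ∈ σ, MvPolynomial.X v

/-- The monomial prime `𝔪^σ = ⟨x_v : v ∈ σ⟩`. -/
noncomputable def monomialPrime (k : Type*) [Field k] (σ : Finset V) :
    Ideal (MvPolynomial V k) :=
  Ideal.span (MvPolynomial.X '' (σ : Set V))

/-- The Stanley-Reisner ideal `⟨x^τ : τ ∉ Δ⟩` of an abstract simplicial complex `Δ` on the vertex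
set `V`. A simplicial complex is a set of finite subsets of `V` that is closed under passing to
subsets; the void complex `∅` and the irrelevant complex `{∅}` are both allowed, and points of `V`
need not be vertices of `Δ`. -/
noncomputable def stanleyReisnerIdeal (k : Type*) [Field k] (Δ : LowerSet (Finset V)) :
    Ideal (MvPolynomial V k) :=
  Ideal.span (sqfreeMonomial k '' {τ | τ ∉ Δ})

/-- The squarefree Alexander dual of a squarefree monomial ideal `I`: the intersection of the
`𝔪^σ` over the squarefree monomials `x^σ` in `I`. The intersection may be taken over any
family of squarefree monomials that generates `I`, see `alexanderDual_span`. -/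
noncomputable def alexanderDual {k : Type*} [Field k] (I : Ideal (MvPolynomial V k)) :
    Ideal (MvPolynomial V k) :=
  ⨅ σ ∈ {σ : Finset V | sqfreeMonomial k σ ∈ I}, monomialPrime k σ

theorem sqfreeMonomial_eq_monomial (k : Type*) [Field k] (σ : Finset V) :
    sqfreeMonomial k σ = MvPolynomial.monomial (∑ v ∈ σ, Finsupp.single v 1) (1 : k) := by
  classical
  unfold sqfreeMonomial
  induction σ using Finset.induction_on with
  | empty => simp
  | insert a s ha ih =>
    rw [Finset.prod_insert ha, Finset.sum_insert ha, ih, MvPolynomial.X,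
      MvPolynomial.monomial_mul, one_mul]

theorem sqfreeMonomial_mem_span_iff (k : Type*) [Field k] (A : Set (Finset V)) (σ : Finset V) :
    sqfreeMonomial k σ ∈ Ideal.span (sqfreeMonomial k '' A) ↔ ∃ τ ∈ A, τ ⊆ σ := by
  classical
  constructor
  · intro h
    have hA : sqfreeMonomial k '' A = (fun s => MvPolynomial.monomial s (1 : k)) ''
        ((fun τ : Finset V => ∑ v ∈ τ, Finsupp.single v 1) '' A) := by
      rw [Set.image_image]
      exact Set.image_congr fun τ _ => sqfreeMonomial_eq_monomial k τ
    rw [hA, MvPolynomial.mem_ideal_span_monomial_image] at h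
    obtain ⟨_, ⟨τ, hτ, rfl⟩, hle⟩ := h (∑ v ∈ σ, Finsupp.single v 1) (by
      rw [sqfreeMonomial_eq_monomial, MvPolynomial.mem_support_iff, MvPolynomial.coeff_monomial]
      simp)
    refine ⟨τ, hτ, fun v hv => ?_⟩
    have hv' := hle v
    simp only [Finsupp.finsetSum_apply, Finsupp.single_apply] at hv'
    by_contra hσ
    simp [hv, hσ] at hv'
  · rintro ⟨τ, hτ, hsub⟩
    exact Ideal.mem_of_dvd _ (Finset.prod_dvd_prod_of_subset _ _ _ hsub)
      (Ideal.subset_span ⟨τ, hτ, rfl⟩)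

/-- `⟨x^σ : σ ∈ A⟩^⋆ = ⋂_{σ ∈ A} 𝔪^σ`. -/
theorem alexanderDual_span (k : Type*) [Field k] (A : Set (Finset V)) :
    alexanderDual (Ideal.span (sqfreeMonomial k '' A)) = ⨅ σ ∈ A, monomialPrime k σ := by
  unfold alexanderDual
  apply le_antisymm
  · refine le_iInf₂ fun σ hσ => ?_
    have hmem : σ ∈ {σ : Finset V |
        sqfreeMonomial k σ ∈ Ideal.span (sqfreeMonomial k '' A)} :=
      (sqfreeMonomial_mem_span_iff k A σ).2 ⟨σ, hσ, Finset.Subset.refl σ⟩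
    exact biInf_le (monomialPrime k) hmem
  · refine le_iInf₂ fun σ hσ => ?_
    obtain ⟨τ, hτ, hsub⟩ := (sqfreeMonomial_mem_span_iff k A σ).1 hσ
    exact (biInf_le (monomialPrime k) hτ).trans
      (Ideal.span_mono (Set.image_mono (Finset.coe_subset.2 hsub)))

end CombinatorialCommutativeAlgebra

/-! ### Function classes -/

section FunctionClasses

variable {n m : ℕ}

/-- The graph of a function `f : [n] → [m]`, as a set of points of `[n] × [m]`. -/
def functionGraph (f : Fin n → Fin m) : Finset (Fin n × Fin m) :=
  Finset.univ.image fun i => (i, f i)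

/-- The canonical suboplex of a class `C ⊆ [n → m]`: the simplicial complex whose faces are the
graphs of the partial functions that have an extension in `C`. -/
def canonicalSuboplex (C : Set (Fin n → Fin m)) : LowerSet (Finset (Fin n × Fin m)) where
  carrier := {σ | ∃ f ∈ C, σ ⊆ functionGraph f}
  lower' := fun _ _ hle ⟨f, hf, hσ⟩ => ⟨f, hf, hle.trans hσ⟩

/-- The canonical ideal of a class `C ⊆ [n → m]`, in the polynomial ring `k[x_{i,j}]`: the Alexander
dual of the Stanley-Reisner ideal of the canonical suboplex of `C`. -/
noncomputable def canonicalIdeal (k : Type*) [Field k] (C : Set (Fin n → Fin m)) :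
    Ideal (MvPolynomial (Fin n × Fin m) k) :=
  alexanderDual (stanleyReisnerIdeal k (canonicalSuboplex C))

/-- The homological dimension of `C`: the projective dimension of its canonical ideal as a module
over the polynomial ring (equal to `⊥`, that is `-∞`, for the zero module only). -/
noncomputable def homologicalDim (k : Type*) [Field k] (C : Set (Fin n → Fin 2)) : WithBot ℕ∞ :=
  CategoryTheory.projectiveDimension
    (ModuleCat.of (MvPolynomial (Fin n × Fin 2) k) (canonicalIdeal k C))

/-- The restriction `C ↾ U ⊆ [U → 2]` of a class `C ⊆ [n → 2]`. -/
def classRestrict (C : Set (Fin n → Fin 2)) (U : Finset (Fin n)) : Set (U → Fin 2) :=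
  (fun f (u : U) => f u) '' C

/-- `C` shatters `U` if `C ↾ U = [U → 2]`. -/
def ClassShatters (C : Set (Fin n → Fin 2)) (U : Finset (Fin n)) : Prop :=
  classRestrict C U = Set.univ

/-- The VC dimension of `C`: the largest size of a set shattered by `C`. It is a natural number
unless `C` is empty; the empty class shatters no set, and its VC dimension is `⊥`, that is `-∞`. -/
noncomputable def classVCDim (C : Set (Fin n → Fin 2)) : WithBot ℕ∞ :=
  ⨆ (U : Finset (Fin n)) (_ : ClassShatters C U), (U.card : WithBot ℕ∞)

end FunctionClasses

/-! ### Transferring nonzero `Ext` classes between ideals. -/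

section ExtOfIdeals

open CategoryTheory Abelian

universe u

variable {R : Type u} [CommRing R]

/-! Let `U` be shattered and let `m` be the product of the variables outside `U`. The canonical
ideal lies in `pairIdeal k U`, and shattering says exactly enough to push `m * pairIdeal k U` back
into it; so the two ideals agree once `m` is inverted. Each `i ∈ U` contributes a pair of fresh
variables to `pairIdeal k U`, hence one Koszul step that raises a nonvanishing `Ext` degree by one
(`exists_ext_ne_zero_of_koszul`). For coefficients take `k` at the point where the variables over
`U` vanish and the others are 1: the Koszul maps act as zero there and `m` as the identity, so a
nonzero class in degree `|U|` survives on the canonical ideal (`exists_ext_ne_zero_of_le`). -/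

theorem ext_smul_eq_zero_of_annihilates {X Y : ModuleCat.{u} R} {n : ℕ} (r : R)
    (hr : ∀ y : Y, r • y = 0) (e : Ext X Y n) : r • e = 0 := by
  have h : r • 𝟙 Y = 0 := by
    ext y
    exact hr y
  rw [Ext.smul_eq_comp_mk₀, h, Ext.mk₀_zero, Ext.comp_zero]

theorem ext_smul_eq_self_of_fixes {X Y : ModuleCat.{u} R} {n : ℕ} (r : R)
    (hr : ∀ y : Y, r • y = y) (e : Ext X Y n) : r • e = e := by
  have h : r • 𝟙 Y = 𝟙 Y := by
    ext y
    exact hr y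
  rw [Ext.smul_eq_comp_mk₀, h, Ext.comp_mk₀_id]

/-- If `J = xI + yI` and the syzygies of `(x, y)` with entries in `I` are the Koszul ones, then
`Ext` classes of `I` with values in a module killed by `x` and `y` are detected on `J` one degree
higher. -/
theorem exists_ext_ne_zero_of_koszul {I J : Ideal R} {x y : R}
    (hx : ∀ a ∈ I, a * x ∈ J) (hy : ∀ a ∈ I, a * y ∈ J)
    (hJ : ∀ p ∈ J, ∃ a ∈ I, ∃ b ∈ I, p = a * x + b * y)
    (hyreg : ∀ a : R, a * y = 0 → a = 0)
    (hsyz : ∀ a ∈ I, ∀ b ∈ I, a * x + b * y = 0 → ∃ c ∈ I, a = c * y ∧ b = -(c * x))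
    {Y : ModuleCat.{u} R} (hxY : ∀ z : Y, x • z = 0) (hyY : ∀ z : Y, y • z = 0)
    {d : ℕ} (h : ∃ e : Ext (ModuleCat.of R I) Y d, e ≠ 0) :
    ∃ e : Ext (ModuleCat.of R J) Y (d + 1), e ≠ 0 := by
  let i₁ : ModuleCat.of R I ⟶ ModuleCat.of R (I × I) := ModuleCat.ofHom (LinearMap.inl R I I)
  let i₂ : ModuleCat.of R I ⟶ ModuleCat.of R (I × I) := ModuleCat.ofHom (LinearMap.inr R I I)
  let g : (I × I) →ₗ[R] J :=
    { toFun := fun p => ⟨p.1 * x + p.2 * y, J.add_mem (hx _ p.1.2) (hy _ p.2.2)⟩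
      map_add' := fun p q => Subtype.ext (by simp; ring)
      map_smul' := fun r p => Subtype.ext (by simp; ring) }
  let S : ShortComplex (ModuleCat.{u} R) :=
    { X₁ := ModuleCat.of R I
      X₂ := ModuleCat.of R (I × I)
      X₃ := ModuleCat.of R J
      f := y • i₁ + (-x) • i₂
      g := ModuleCat.ofHom g
      zero := by
        ext a
        simp [g, i₁, i₂]
        ring }
  have hS : S.ShortExact :=
    { exact := by
        rw [ShortComplex.moduleCat_exact_iff]
        rintro ⟨⟨a, ha⟩, ⟨b, hb⟩⟩ hab
        obtain ⟨c, hc, rfl, rfl⟩ := hsyz a ha b hb (congrArg Subtype.val hab)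
        refine ⟨⟨c, hc⟩, Prod.ext (Subtype.ext ?_) (Subtype.ext ?_)⟩
        · simp [S, i₁, i₂, mul_comm]
        · simp [S, i₁, i₂, mul_comm]
      mono_f := by
        rw [ModuleCat.mono_iff_injective, injective_iff_map_eq_zero]
        rintro ⟨a, ha⟩ h0
        have h1 := congrArg (fun p : I × I => (p.1 : R)) h0
        refine Subtype.ext (hyreg a ?_)
        simpa [S, i₁, i₂, mul_comm] using h1
      epi_g := by
        rw [ModuleCat.epi_iff_surjective]
        rintro ⟨p, hp⟩
        obtain ⟨a, ha, b, hb, rfl⟩ := hJ p hp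
        exact ⟨(⟨a, ha⟩, ⟨b, hb⟩), rfl⟩ }
  obtain ⟨e, he⟩ := h
  refine ⟨hS.extClass.comp e (add_comm 1 d), fun h0 => he ?_⟩
  -- A class killed by the connecting map is pulled back along `S.f`, whose components are multiples
  -- of `x` and `y` and so act as zero on `Ext` into `Y`.
  obtain ⟨e', rfl⟩ := Ext.contravariant_sequence_exact₁ hS Y e (add_comm 1 d) h0
  have hf : Ext.mk₀ S.f = y • Ext.mk₀ i₁ + (-x) • Ext.mk₀ i₂ := by
    rw [← Ext.mk₀_smul, ← Ext.mk₀_smul, ← Ext.mk₀_add]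
  rw [hf, Ext.add_comp, Ext.smul_comp, Ext.smul_comp, ext_smul_eq_zero_of_annihilates y hyY,
    ext_smul_eq_zero_of_annihilates (-x) (fun z => by rw [neg_smul, hxY, neg_zero]), add_zero]

/-- If `m J ⊆ I ⊆ J` and `m` acts as the identity on `Y`, then a nonzero class in `Ext J Y`
restricts to a nonzero class in `Ext I Y`. -/
theorem exists_ext_ne_zero_of_le {I J : Ideal R} (hIJ : I ≤ J) {m : R}
    (hm : ∀ p ∈ J, m * p ∈ I) {Y : ModuleCat.{u} R} (hmY : ∀ z : Y, m • z = z) {d : ℕ}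
    (h : ∃ e : Ext (ModuleCat.of R J) Y d, e ≠ 0) :
    ∃ e : Ext (ModuleCat.of R I) Y d, e ≠ 0 := by
  let ι : ModuleCat.of R I ⟶ ModuleCat.of R J := ModuleCat.ofHom (Submodule.inclusion hIJ)
  let μ : ModuleCat.of R J ⟶ ModuleCat.of R I :=
    ModuleCat.ofHom ((LinearMap.lsmul R R m).restrict hm)
  have hμι : μ ≫ ι = m • 𝟙 _ := by
    ext p
    rfl
  obtain ⟨e, he⟩ := h
  refine ⟨(Ext.mk₀ ι).comp e (zero_add d), fun h0 => he ?_⟩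
  have h1 := congrArg (fun t => (Ext.mk₀ μ).comp t (zero_add d)) h0
  simpa only [Ext.mk₀_comp_mk₀_assoc, hμι, Ext.mk₀_smul, Ext.smul_comp, Ext.mk₀_id_comp,
    Ext.comp_zero, ext_smul_eq_self_of_fixes m hmY] using h1

end ExtOfIdeals

/-! ### Intersections of pair primes. -/

section PairIdeals

open MvPolynomial

variable {n : ℕ} (k : Type*) [Field k]

/-- The ideal `⋂_{i ∈ T} ⟨x_{i,0}, x_{i,1}⟩`. -/
noncomputable def pairIdeal (T : Finset (Fin n)) : Ideal (MvPolynomial (Fin n × Fin 2) k) :=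
  ⨅ i ∈ T, monomialPrime k {(i, 0), (i, 1)}

variable {k}

theorem mem_monomialPrime_iff {V : Type*} {σ : Finset V} {p : MvPolynomial V k} :
    p ∈ monomialPrime k σ ↔ ∀ s ∈ p.support, ∃ v ∈ σ, s v ≠ 0 := by
  simp only [monomialPrime, mem_ideal_span_X_image, Finset.mem_coe]

theorem mem_pairIdeal_iff {T : Finset (Fin n)} {p : MvPolynomial (Fin n × Fin 2) k} :
    p ∈ pairIdeal k T ↔ ∀ s ∈ p.support, ∀ i ∈ T, ∃ j, s (i, j) ≠ 0 := by
  simp only [pairIdeal, Submodule.mem_iInf, mem_monomialPrime_iff, Finset.mem_insert,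
    Finset.mem_singleton, exists_eq_or_imp, exists_eq_left, Fin.exists_fin_two]
  exact ⟨fun h s hs i hi => h i hi s hs, fun h i hi s hs => h s hs i hi⟩

theorem pairIdeal_insert (i : Fin n) (T : Finset (Fin n)) :
    pairIdeal k (insert i T) = monomialPrime k {(i, 0), (i, 1)} ⊓ pairIdeal k T := by
  classical
  simp only [pairIdeal, Finset.iInf_insert]

theorem X_mem_monomialPrime {V : Type*} {σ : Finset V} {v : V} (hv : v ∈ σ) :
    (X v : MvPolynomial V k) ∈ monomialPrime k σ :=
  Ideal.subset_span ⟨v, hv, rfl⟩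

theorem mul_X_mem_pairIdeal_insert {i : Fin n} {T : Finset (Fin n)} (j : Fin 2)
    {p : MvPolynomial (Fin n × Fin 2) k} (hp : p ∈ pairIdeal k T) :
    p * X (i, j) ∈ pairIdeal k (insert i T) := by
  rw [pairIdeal_insert]
  refine ⟨Ideal.mul_mem_left _ _ (X_mem_monomialPrime ?_), Ideal.mul_mem_right _ _ hp⟩
  fin_cases j <;> simp

theorem mem_pairIdeal_of_mul_X_mem {i : Fin n} {T : Finset (Fin n)} (hi : i ∉ T) {j : Fin 2}
    {p : MvPolynomial (Fin n × Fin 2) k} (hp : p * X (i, j) ∈ pairIdeal k T) :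
    p ∈ pairIdeal k T := by
  rw [mem_pairIdeal_iff] at hp ⊢
  intro s hs i' hi'
  obtain ⟨j', hj'⟩ := hp (s + Finsupp.single (i, j) 1)
    (by rwa [mem_support_iff, coeff_mul_X, ← mem_support_iff]) i' hi'
  have hne : (i, j) ≠ (i', j') := fun h => hi (by rw [(Prod.mk.inj h).1]; exact hi')
  exact ⟨j', by simpa [Finsupp.single_apply, hne] using hj'⟩

theorem exists_eq_of_mem_pairIdeal_insert {i : Fin n} {T : Finset (Fin n)} (hi : i ∉ T)
    {p : MvPolynomial (Fin n × Fin 2) k} (hp : p ∈ pairIdeal k (insert i T)) :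
    ∃ a ∈ pairIdeal k T, ∃ b ∈ pairIdeal k T, p = a * X (i, 0) + b * X (i, 1) := by
  classical
  -- Argue monomial by monomial: each term is divisible by one of the two new variables, and the
  -- quotient stays in `pairIdeal k T` because `i ∉ T`.
  have key : p ∈ pairIdeal k T * Ideal.span {X (i, 0), X (i, 1)} := by
    rw [p.as_sum]
    refine Ideal.sum_mem _ fun s hs => ?_
    rw [mem_pairIdeal_iff] at hp
    obtain ⟨j, hj⟩ := hp s hs i (Finset.mem_insert_self i T)
    have hle : Finsupp.single (i, j) 1 ≤ s :=
      Finsupp.single_le_iff.2 (Nat.one_le_iff_ne_zero.2 hj)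
    have hfac : monomial s (coeff s p) =
        monomial (s - Finsupp.single (i, j) 1) (coeff s p) * X (i, j) := by
      rw [X, monomial_mul, mul_one, tsub_add_cancel_of_le hle]
    have hmem : monomial s (coeff s p) ∈ pairIdeal k T := by
      rw [mem_pairIdeal_iff]
      intro t ht i' hi'
      rw [Finset.mem_singleton.1 (support_monomial_subset ht)]
      exact hp s hs i' (Finset.mem_insert_of_mem hi')
    rw [hfac] at hmem ⊢
    refine Ideal.mul_mem_mul (mem_pairIdeal_of_mul_X_mem hi hmem) (Ideal.subset_span ?_)
    fin_cases j <;> simp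
  rw [Ideal.span_insert, Ideal.mul_sup, Submodule.mem_sup] at key
  obtain ⟨_, h₁, _, h₂, rfl⟩ := key
  obtain ⟨a, ha, rfl⟩ := Ideal.mem_mul_span_singleton.1 h₁
  obtain ⟨b, hb, rfl⟩ := Ideal.mem_mul_span_singleton.1 h₂
  exact ⟨a, ha, b, hb, rfl⟩

theorem exists_of_pairIdeal_syzygy {i : Fin n} {T : Finset (Fin n)} (hi : i ∉ T)
    {a b : MvPolynomial (Fin n × Fin 2) k} (ha : a ∈ pairIdeal k T)
    (hab : a * X (i, 0) + b * X (i, 1) = 0) :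
    ∃ c ∈ pairIdeal k T, a = c * X (i, 1) ∧ b = -(c * X (i, 0)) := by
  have hdvd : (X (i, 1) : MvPolynomial (Fin n × Fin 2) k) ∣ a * X (i, 0) :=
    ⟨-b, by linear_combination hab⟩
  obtain ⟨c, rfl⟩ := (X_prime.dvd_or_dvd hdvd).resolve_right (by simp [X_dvd_X])
  rw [mul_comm] at ha
  refine ⟨c, mem_pairIdeal_of_mul_X_mem hi ha, mul_comm _ _, ?_⟩
  refine mul_right_cancel₀ (X_ne_zero (R := k) (i, (1 : Fin 2))) ?_
  linear_combination hab

end PairIdeals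

/-! ### Comparison with the canonical ideal. -/

section HomologicalDimension

open CategoryTheory Abelian MvPolynomial

universe u

variable {n : ℕ} {k : Type u} [Field k]

theorem exists_ext_pairIdeal_ne_zero {Y : ModuleCat.{u} (MvPolynomial (Fin n × Fin 2) k)}
    [Nontrivial Y] (T : Finset (Fin n))
    (hY : ∀ i ∈ T, ∀ j, ∀ z : Y, (X (i, j) : MvPolynomial (Fin n × Fin 2) k) • z = 0) :
    ∃ e : Ext (ModuleCat.of _ (pairIdeal k T)) Y T.card, e ≠ 0 := by
  classical
  induction T using Finset.induction_on with
  | empty =>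
    obtain ⟨z, hz⟩ := exists_ne (0 : Y)
    let φ : ModuleCat.of _ (pairIdeal k (∅ : Finset (Fin n))) ⟶ Y :=
      ModuleCat.ofHom ((LinearMap.toSpanSingleton _ Y z).comp (Submodule.subtype _))
    refine ⟨Ext.mk₀ φ, fun h0 => hz ?_⟩
    have hφ : φ = 0 := Ext.homEquiv₀.symm.injective (h0.trans (Ext.mk₀_zero _ _).symm)
    have h1 : (1 : MvPolynomial (Fin n × Fin 2) k) ∈ pairIdeal k (∅ : Finset (Fin n)) := by
      simp [pairIdeal]
    have h2 : φ.hom ⟨1, h1⟩ = 0 := by rw [hφ]; rfl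
    simpa [φ] using h2
  | insert i T hi ih =>
    rw [Finset.card_insert_of_notMem hi]
    refine exists_ext_ne_zero_of_koszul
      (fun a ha => mul_X_mem_pairIdeal_insert 0 ha)
      (fun a ha => mul_X_mem_pairIdeal_insert 1 ha)
      (fun p hp => exists_eq_of_mem_pairIdeal_insert hi hp)
      (fun a h => (mul_eq_zero.1 h).resolve_right (X_ne_zero _))
      (fun a ha b _ hab => exists_of_pairIdeal_syzygy hi ha hab)
      (hY i (Finset.mem_insert_self i T) 0) (hY i (Finset.mem_insert_self i T) 1)
      (ih fun i' hi' => hY i' (Finset.mem_insert_of_mem hi'))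

theorem canonicalIdeal_eq (C : Set (Fin n → Fin 2)) :
    canonicalIdeal k C = ⨅ σ ∈ {τ | τ ∉ canonicalSuboplex C}, monomialPrime k σ :=
  alexanderDual_span k _

theorem mem_functionGraph_iff {m : ℕ} {f : Fin n → Fin m} {v : Fin n × Fin m} :
    v ∈ functionGraph f ↔ f v.1 = v.2 := by
  simp [functionGraph, Prod.ext_iff]

/-- A function takes one value at `i`, so each pair over `i` is a nonface. -/
theorem canonicalIdeal_le_pairIdeal (C : Set (Fin n → Fin 2)) (U : Finset (Fin n)) :
    canonicalIdeal k C ≤ pairIdeal k U := by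
  rw [canonicalIdeal_eq]
  refine le_iInf₂ fun i _ => iInf₂_le _ ?_
  rintro ⟨f, -, hf⟩
  have h0 := mem_functionGraph_iff.1 (hf (Finset.mem_insert_self (i, (0 : Fin 2)) _))
  have h1 := mem_functionGraph_iff.1
    (hf (Finset.mem_insert_of_mem (Finset.mem_singleton_self (i, (1 : Fin 2)))))
  exact absurd (h0.symm.trans h1) (by simp)

theorem sqfreeMonomial_mul_mem_canonicalIdeal {C : Set (Fin n → Fin 2)} {U : Finset (Fin n)}
    (hU : ClassShatters C U) {p : MvPolynomial (Fin n × Fin 2) k} (hp : p ∈ pairIdeal k U) :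
    sqfreeMonomial k (Uᶜ ×ˢ Finset.univ) * p ∈ canonicalIdeal k C := by
  classical
  rw [mem_pairIdeal_iff] at hp
  rw [canonicalIdeal_eq]
  simp only [Submodule.mem_iInf]
  intro σ hσ
  by_cases hσU : ∃ v ∈ σ, v.1 ∉ U
  · obtain ⟨v, hv, hvU⟩ := hσU
    refine Ideal.mul_mem_right _ _ (Ideal.mem_of_dvd _ ?_ (X_mem_monomialPrime hv))
    exact Finset.dvd_prod_of_mem _ (by simp [hvU])
  · push Not at hσU
    refine Ideal.mul_mem_left _ _ (mem_monomialPrime_iff.2 fun s hs => ?_)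
    choose! g hg using hp s hs
    -- The variables `x_{i, g i}`, `i ∈ U`, divide the monomial `s`. Shattering realises the
    -- opposite pattern `1 - g`; a nonface over `U` leaves that graph, so it contains some `(i, g
    -- i)`.
    obtain ⟨f, hf, hfg⟩ : (fun i : U => 1 - g i) ∈ classRestrict C U := by
      rw [show classRestrict C U = Set.univ from hU]
      trivial
    have hnot : ¬ σ ⊆ functionGraph f := fun h => hσ ⟨f, hf, h⟩
    obtain ⟨⟨i, j⟩, hv, hvf⟩ := Finset.not_subset.1 hnot
    refine ⟨(i, j), hv, ?_⟩
    have hi := hσU _ hv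
    have hfi : f i = 1 - g i := congrFun hfg ⟨i, hi⟩
    rw [mem_functionGraph_iff] at hvf
    have hj : j = g i := by
      dsimp only at hvf
      omega
    rw [hj]
    exact hg i hi

theorem exists_ext_canonicalIdeal_ne_zero {C : Set (Fin n → Fin 2)} {U : Finset (Fin n)}
    (hU : ClassShatters C U) :
    ∃ (Y : ModuleCat.{u} (MvPolynomial (Fin n × Fin 2) k))
      (e : Ext (ModuleCat.of _ (canonicalIdeal k C)) Y U.card), e ≠ 0 := by
  classical
  let φ : MvPolynomial (Fin n × Fin 2) k →+* k := eval fun v => if v.1 ∈ U then 0 else 1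
  let : Module (MvPolynomial (Fin n × Fin 2) k) k := Module.compHom k φ
  have hsmul : ∀ (r : MvPolynomial (Fin n × Fin 2) k) (z : k), r • z = φ r * z := fun _ _ => rfl
  refine ⟨ModuleCat.of _ k, exists_ext_ne_zero_of_le (canonicalIdeal_le_pairIdeal C U)
    (fun p hp => sqfreeMonomial_mul_mem_canonicalIdeal hU hp) (fun z => ?_)
    (exists_ext_pairIdeal_ne_zero U fun i hi j z => ?_)⟩
  · refine (hsmul _ _).trans ?_
    have h1 : φ (sqfreeMonomial k (Uᶜ ×ˢ Finset.univ)) = 1 := by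
      rw [sqfreeMonomial, map_prod]
      refine Finset.prod_eq_one fun v hv => ?_
      have hv' : v.1 ∉ U := by simpa using hv
      simp [φ, hv']
    rw [h1, one_mul]
  · refine (hsmul _ _).trans ?_
    simp [φ, hi]

end HomologicalDimension

theorem mainTheorem1 (k : Type*) [Field k] (n : ℕ) (C : Set (Fin n → Fin 2)) :
    classVCDim C ≤ homologicalDim k C := by
  refine iSup₂_le fun U hU => ?_
  by_contra h
  obtain ⟨Y, e, he⟩ := exists_ext_canonicalIdeal_ne_zero (k := k) hU
  -- Projective dimension below `|U|` already kills `Ext` in degree `|U|` itself.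
  have hpd := CategoryTheory.projectiveDimension_lt_iff.1 (not_le.1 h)
  exact he (e.eq_zero_of_hasProjectiveDimensionLT U.card le_rfl)
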